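/- Fix countably infinite, pairwise disjoint sets of constants, labeled nulls and variables. A database schema is a finite set of relation symbols with positive arities; an instance is a finite set of facts $R(v_1,\dots,v_k)$ whose arguments are constants or labeled nulls. A constraint is either a tuple-generating dependency (TGD) $\forall \bar x\,(\phi(\bar x)\to\exists \bar y\,\psi(\bar x,\bar y))$, where $\phi,\psi$ are conjunctions of relational atoms over variables and constants, $\psi$ is non-empty, $\phi$ may be empty, and every universally quantified variable of $\psi$ occurs in $\phi$; or an equality-generating dependency (EGD) $\forall \bar x\,(\phi(\bar x)\to x_i=x_j)$ with $\phi$ a non-empty such conjunction containing $x_i$ and $x_j$. A chase step $I\xrightarrow{\alpha,\bar a}J$ is possible only if $I\not\models\alpha(\bar a)$. If $\alpha$ is a TGD, $J$ is obtained from $I$ by adding the head $\psi$ of $\alpha$, where the existential variables are instantiated by distinct labeled nulls not occurring in $I$. If $\alpha$ is an EGD, $J$ is obtained from $I$ by replacing everywhere one of the two values to be equated, which must be a labeled null, by the other; if both are constants, the step cannot be performed and the chase fails. A chase sequence of $I$ with a finite set $\Sigma$ of constraints is a sequence of chase steps with constraints from $\Sigma$, starting in $I$, that is infinite, or finite and ending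 in a model of $\Sigma$ or in a failure; no order is imposed on the steps. A constraint $\alpha\in\Sigma$ is $(I,\Sigma)$-irrelevant if $\alpha$ fires (is applied in some step) in no chase sequence of $I$ with $\Sigma$. Theorem. $(I,\Sigma)$-irrelevance is undecidable: there is a database schema $\mathcal R$ such that no algorithm decides, given a finite set $\Sigma$ of constraints over $\mathcal R$, a constraint $\alpha\in\Sigma$ and an instance $I$ over $\mathcal R$, whether $\alpha$ is $(I,\Sigma)$-irrelevant. (In particular, the problem is undecidable if the schema is part of the input.) -/

import Mathlib

namespace Chase

/-- The elements that may occur in an instance, `Δ ∪ Δ_null`: `Sum.inl c` is a constant and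
`Sum.inr n` is a labeled null. -/
abbrev Value := ℕ ⊕ ℕ

/-- The terms that may occur in a constraint, `Δ ∪ V`: `Sum.inl c` is a constant (a parameter) and
`Sum.inr x` is a variable. -/
abbrev Term := ℕ ⊕ ℕ

/-- `R_i(t_1, …, t_k)` is represented as `(i, [t_1, …, t_k])`. -/
abbrev Atom := ℕ × List Term

/-- An atom over constants and labeled nulls. -/
abbrev Fact := ℕ × List Value

/-- An instance is a finite set of facts. -/
abbrev Instance := Finset Fact

/-- A finite list of relation symbols `R_0, …, R_{n-1}`, given by their arities. -/
abbrev Schema := List ℕ+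

/-- A constraint. `Sum.inl (φ, ψ)` is the TGD `∀ x̄ (⋀ φ → ∃ ȳ ⋀ ψ)`, where `ȳ` are the variables
of `ψ` that do not occur in `φ`; `Sum.inr (φ, x, y)` is the EGD `∀ x̄ (⋀ φ → x = y)`. -/
abbrev Constraint := (List Atom × List Atom) ⊕ (List Atom × ℕ × ℕ)

/-- The TGD with body `φ` and head `ψ`. -/
abbrev tgd (φ ψ : List Atom) : Constraint := Sum.inl (φ, ψ)

/-- The EGD with body `φ` that equates the variables `x` and `y`. -/
abbrev egd (φ : List Atom) (x y : ℕ) : Constraint := Sum.inr (φ, x, y)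

/-- `x` occurs in the conjunction `φ`. -/
def Occurs (x : ℕ) (φ : List Atom) : Prop := ∃ A ∈ φ, (Sum.inr x : Term) ∈ A.2

/-- The `i`-th relation symbol exists and has the right number of arguments (for atoms and facts
alike). -/
def OverSchema (R : Schema) (A : ℕ × List (ℕ ⊕ ℕ)) : Prop :=
  ∃ k : ℕ+, R[A.1]? = some k ∧ A.2.length = (k : ℕ)

/-- The constraint is a TGD with nonempty head or an EGD with nonempty body containing both equated
variables, with all its atoms over the schema. -/
def IsConstraint (R : Schema) : Constraint → Prop
  | Sum.inl (φ, ψ) => ψ ≠ [] ∧ (∀ A ∈ φ, OverSchema R A) ∧ (∀ A ∈ ψ, OverSchema R A)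
  | Sum.inr (φ, x, y) => φ ≠ [] ∧ (∀ A ∈ φ, OverSchema R A) ∧ Occurs x φ ∧ Occurs y φ

/-- All facts of the instance are over the schema. -/
def IsInstance (R : Schema) (I : Instance) : Prop := ∀ F ∈ I, OverSchema R F

/-- An assignment of values to variables. -/
abbrev Assignment := ℕ → Value

/-- The value of a term: constants are kept, variables are looked up. -/
def termValue (a : Assignment) : Term → Value
  | Sum.inl c => Sum.inl c
  | Sum.inr x => a x

/-- The fact obtained from an atom under an assignment. -/
def atomFact (a : Assignment) (A : Atom) : Fact := (A.1, A.2.map (termValue a))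

/-- All atoms of the conjunction hold in `I` under the assignment `a`. -/
def Holds (I : Instance) (a : Assignment) (φ : List Atom) : Prop := ∀ A ∈ φ, atomFact a A ∈ I

/-- `b` agrees with `a` on the variables of `φ`. -/
def AgreeOn (φ : List Atom) (a b : Assignment) : Prop := ∀ x, Occurs x φ → b x = a x

/-- `I ⊨ α(a)`. -/
def SatisfiesAt (I : Instance) (a : Assignment) : Constraint → Prop
  | Sum.inl (φ, ψ) => Holds I a φ → ∃ b, AgreeOn φ a b ∧ Holds I b ψ
  | Sum.inr (φ, x, y) => Holds I a φ → a x = a y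

/-- `v` appears in `I`, that is, `v ∈ dom I`. -/
def InDom (I : Instance) (v : Value) : Prop := ∃ F ∈ I, v ∈ F.2

/-- `b` extends `a` (given on the variables of `φ`) to the existential variables of the TGD, mapping
them to pairwise distinct labeled nulls that are fresh for `I`. -/
def FreshExtension (I : Instance) (φ ψ : List Atom) (a b : Assignment) : Prop :=
  AgreeOn φ a b ∧
  (∀ y, Occurs y ψ → ¬ Occurs y φ → (∃ n : ℕ, b y = Sum.inr n) ∧ ¬ InDom I (b y)) ∧
  (∀ y z, Occurs y ψ → ¬ Occurs y φ → Occurs z ψ → ¬ Occurs z φ → b y = b z → y = z)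

/-- `I` with the value `u` replaced everywhere by `v`. -/
def replaceValue (u v : Value) (I : Instance) : Instance :=
  I.image fun F => (F.1, F.2.map fun w => if w = u then v else w)

/-- The chase step from `I` to `J` with `α` and `a`. It needs `I ⊭ α(a)`. A TGD adds its head, with
fresh nulls for the existential variables; an EGD replaces one of the two values to be equated, which
must be a null, by the other one. -/
def ChaseStep (α : Constraint) (a : Assignment) (I J : Instance) : Prop :=
  ¬ SatisfiesAt I a α ∧
  match α with
  | Sum.inl (φ, ψ) => ∃ b, FreshExtension I φ ψ a b ∧ J = I ∪ (ψ.map (atomFact b)).toFinset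
  | Sum.inr (_, x, y) =>
      (∃ n : ℕ, a x = Sum.inr n ∧ J = replaceValue (a x) (a y) I) ∨
      (∃ n : ℕ, a y = Sum.inr n ∧ J = replaceValue (a y) (a x) I)

/-- `α` is an EGD that would have to equate two distinct constants. -/
def ChaseFails (α : Constraint) (a : Assignment) (I : Instance) : Prop :=
  ¬ SatisfiesAt I a α ∧
  match α with
  | Sum.inl _ => False
  | Sum.inr (_, x, y) => ∃ c d : ℕ, a x = Sum.inl c ∧ a y = Sum.inl d

/-- A chase sequence of `I₀` with `S`, finite or infinite, of length `len`: the `n`-th step, for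
`n < len`, leads from `inst n` to `inst (n + 1)` with the constraint `con n` and the assignment
`asg n`. (Entries beyond the length carry no meaning.) A finite sequence is exhaustive: it ends in a
model of `S` or with a failure. -/
structure ChaseSequence (S : Set Constraint) (I₀ : Instance) where
  len : ℕ∞
  inst : ℕ → Instance
  con : ℕ → Constraint
  asg : ℕ → Assignment
  start : inst 0 = I₀
  con_mem : ∀ n : ℕ, (n : ℕ∞) < len → con n ∈ S
  step : ∀ n : ℕ, (n : ℕ∞) < len → ChaseStep (con n) (asg n) (inst n) (inst (n + 1))
  exhaustive : ∀ n : ℕ, len = (n : ℕ∞) →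
    (∀ α ∈ S, ∀ a, SatisfiesAt (inst n) a α) ∨ (∃ α ∈ S, ∃ a, ChaseFails α a (inst n))

/-- `α` is `(I, S)`-irrelevant: it fires in no chase sequence of `I` with `S`. -/
def Irrelevant (I : Instance) (S : Set Constraint) (α : Constraint) : Prop :=
  ¬ ∃ s : ChaseSequence S I, ∃ n : ℕ, (n : ℕ∞) < s.len ∧ s.con n = α

end Chase

namespace Chase

/-! ### Extending chase steps to chase sequences -/

/-! The halting problem is reduced to irrelevance. The constraints are fixed TGDs whose bodies and
heads are the clauses of a big-step semantics for `Turing.ToPartrec.Code`; only the instance varies,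
describing a fixed program and its input `[n]`. The rule `haltRule` needs a derived evaluation fact
for that run, and it fires in some chase sequence exactly when the run halts.

If it fires, the run halts: the rules are all true in the infinite model `Intended`, so a
homomorphism from the initial instance into that model can be carried along every chase step
(`IsHom.chaseStep`). The body of a firing rule is therefore true there, which supplies an output of
the program. No order of steps and no termination has to be assumed.

If the run halts, induction on the program shows that the chase can derive its evaluation fact
(`evalReached_of_mem_eval`). Only evaluation rules are used on the way, so the head of `haltRule` is
still false and the rule is applicable. Every finite run of steps extends to a complete chase
sequence (`not_irrelevant_of_reaches`). Choosing a program with undecidable halting problem finishes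
the proof. -/

theorem exists_fresh_bound (I : Instance) : ∃ N : ℕ, ∀ n, N ≤ n → ¬ InDom I (Sum.inr n) := by
  let V : Finset Value := I.biUnion fun F => F.2.toFinset
  let g : Value → ℕ := fun v => v.elim (fun _ => 0) id
  refine ⟨V.sup g + 1, fun n hn ⟨F, hF, hm⟩ => ?_⟩
  have h : g (Sum.inr n) ≤ V.sup g :=
    Finset.le_sup (f := g) (Finset.mem_biUnion.2 ⟨F, hF, List.mem_toFinset.2 hm⟩)
  have h' : g (Sum.inr n) = n := rfl
  omega

theorem exists_freshExtension (I : Instance) (φ ψ : List Atom) (a : Assignment) :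
    ∃ b, FreshExtension I φ ψ a b := by
  classical
  obtain ⟨N, hN⟩ := exists_fresh_bound I
  refine ⟨fun x => if Occurs x φ then a x else Sum.inr (N + x), fun x hx => by simp [hx],
    fun y _ hy => ?_, fun y z _ hy _ hz h => ?_⟩
  · simpa [hy] using hN (N + y) (by omega)
  · simpa [hy, hz] using h

/-- No chase step is required any more: the instance is a model, or the chase fails. -/
def Terminal (S : Set Constraint) (I : Instance) : Prop :=
  (∀ α ∈ S, ∀ a, SatisfiesAt I a α) ∨ (∃ α ∈ S, ∃ a, ChaseFails α a I)

/-- Freshness never blocks a violated TGD, and a violated EGD is blocked only if both values are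
constants, which is the failing case. -/
theorem exists_chaseStep_of_not_terminal {S : Set Constraint} {I : Instance}
    (h : ¬ Terminal S I) : ∃ α ∈ S, ∃ a J, ChaseStep α a I J := by
  simp only [Terminal, not_or, not_forall] at h
  obtain ⟨⟨α, hα, a, ha⟩, hf⟩ := h
  refine ⟨α, hα, a, ?_⟩
  rcases α with ⟨φ, ψ⟩ | ⟨φ, x, y⟩
  · obtain ⟨b, hb⟩ := exists_freshExtension I φ ψ a
    exact ⟨_, ha, b, hb, rfl⟩
  · rcases hx : a x with c | n
    · rcases hy : a y with d | n
      · exact absurd ⟨_, hα, a, ha, c, d, hx, hy⟩ hf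
      · exact ⟨_, ha, Or.inr ⟨n, hy, rfl⟩⟩
    · exact ⟨_, ha, Or.inl ⟨n, hx, rfl⟩⟩

/-- Iterate an arbitrary choice of steps and cut the sequence at the first terminal instance, if
there is one. -/
theorem exists_chaseSequence (S : Set Constraint) (I : Instance) : Nonempty (ChaseSequence S I) := by
  classical
  have hstep : ∀ K : Instance, ∃ p : Constraint × Assignment × Instance,
      ¬ Terminal S K → p.1 ∈ S ∧ ChaseStep p.1 p.2.1 K p.2.2 := fun K => by
    by_cases h : Terminal S K
    -- A filler: steps chosen at terminal instances lie beyond the length of the sequence.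
    · exact ⟨(Sum.inl ([], []), fun _ => Sum.inl 0, K), fun h' => absurd h h'⟩
    · obtain ⟨α, hα, a, J, hJ⟩ := exists_chaseStep_of_not_terminal h
      exact ⟨(α, a, J), fun _ => ⟨hα, hJ⟩⟩
  choose p hp using hstep
  let inst : ℕ → Instance := fun n => (fun K => (p K).2.2)^[n] I
  have hinst : ∀ n, inst (n + 1) = (p (inst n)).2.2 := fun n =>
    Function.iterate_succ_apply' _ _ _
  by_cases hT : ∃ n, Terminal S (inst n)
  · have hlt : ∀ n : ℕ, (n : ℕ∞) < (Nat.find hT : ℕ∞) → ¬ Terminal S (inst n) := fun n hn =>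
      Nat.find_min hT (by exact_mod_cast hn)
    exact ⟨{
      len := (Nat.find hT : ℕ∞)
      inst := inst
      con := fun n => (p (inst n)).1
      asg := fun n => (p (inst n)).2.1
      start := rfl
      con_mem := fun n hn => (hp _ (hlt n hn)).1
      step := fun n hn => by rw [hinst]; exact (hp _ (hlt n hn)).2
      exhaustive := fun n hn => by
        have : Nat.find hT = n := by exact_mod_cast hn
        exact this ▸ Nat.find_spec hT }⟩
  · have hT' : ∀ n, ¬ Terminal S (inst n) := fun n hn => hT ⟨n, hn⟩
    exact ⟨{
      len := ⊤
      inst := inst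
      con := fun n => (p (inst n)).1
      asg := fun n => (p (inst n)).2.1
      start := rfl
      con_mem := fun n _ => (hp _ (hT' n)).1
      step := fun n _ => by rw [hinst]; exact (hp _ (hT' n)).2
      exhaustive := fun n hn => absurd hn (ENat.top_ne_natCast n) }⟩

/-- Prepend a chase step to a chase sequence. -/
def ChaseSequence.cons {S : Set Constraint} {I J : Instance} {α : Constraint} {a : Assignment}
    (hα : α ∈ S) (h : ChaseStep α a I J) (s : ChaseSequence S J) : ChaseSequence S I where
  len := s.len + 1
  inst n := Nat.casesOn n I s.inst
  con n := Nat.casesOn n α s.con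
  asg n := Nat.casesOn n a s.asg
  start := rfl
  con_mem n hn := by
    cases n with
    | zero => exact hα
    | succ n =>
      rw [Nat.cast_succ] at hn
      exact s.con_mem n (lt_of_add_lt_add_right hn)
  step n hn := by
    cases n with
    | zero =>
      change ChaseStep α a I (s.inst 0)
      rwa [s.start]
    | succ n =>
      rw [Nat.cast_succ] at hn
      exact s.step n (lt_of_add_lt_add_right hn)
  exhaustive n hn := by
    cases n with
    | zero => simp at hn
    | succ n =>
      rw [Nat.cast_succ] at hn
      exact s.exhaustive n ((ENat.add_left_injective_of_ne_top ENat.one_ne_top hn))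

/-- `J` is obtained from `I` by finitely many chase steps. -/
def Reaches (S : Set Constraint) : Instance → Instance → Prop :=
  Relation.ReflTransGen fun I J => ∃ α ∈ S, ∃ a, ChaseStep α a I J

theorem Reaches.mono {S T : Set Constraint} (h : S ⊆ T) {I J : Instance} (hr : Reaches S I J) :
    Reaches T I J :=
  Relation.ReflTransGen.mono (fun _ _ ⟨α, hα, a, ha⟩ => ⟨α, h hα, a, ha⟩) _ _ hr

/-- Continue arbitrarily after the step with `α`, then prepend the steps leading to it one at a
time. -/
theorem not_irrelevant_of_reaches {S : Set Constraint} {I J K : Instance} {α : Constraint}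
    {a : Assignment} (hr : Reaches S I J) (hα : α ∈ S) (h : ChaseStep α a J K) :
    ¬ Irrelevant I S α := by
  rw [Irrelevant, not_not]
  induction hr using Relation.ReflTransGen.head_induction_on with
  | refl =>
    obtain ⟨s⟩ := exists_chaseSequence S K
    exact ⟨s.cons hα h, 0, by simp [ChaseSequence.cons], rfl⟩
  | head hstep _ ih =>
    obtain ⟨β, hβ, c, hc⟩ := hstep
    obtain ⟨s, n, hn, hs⟩ := ih
    refine ⟨s.cons hβ hc, n + 1, ?_, hs⟩
    rw [Nat.cast_succ]
    exact (ENat.add_lt_add_iff_right ENat.one_ne_top).2 hn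

/-! ### Chasing with tuple-generating dependencies -/

/-- A step is forbidden when the head already has witnesses, but then those witnesses serve and no
step is needed. -/
theorem reaches_tgd_of_holds {S : Set Constraint} {φ ψ : List Atom} (hS : tgd φ ψ ∈ S)
    {I : Instance} {a : Assignment} (ha : Holds I a φ) :
    ∃ J b, Reaches S I J ∧ AgreeOn φ a b ∧ Holds J b ψ := by
  by_cases h : SatisfiesAt I a (tgd φ ψ)
  · obtain ⟨b, hb, hψ⟩ := h ha
    exact ⟨I, b, Relation.ReflTransGen.refl, hb, hψ⟩
  · obtain ⟨b, hb⟩ := exists_freshExtension I φ ψ a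
    refine ⟨_, b, Relation.ReflTransGen.single ⟨_, hS, a, h, b, hb, rfl⟩, hb.1, fun A hA => ?_⟩
    exact Finset.mem_union_right _ (List.mem_toFinset.2 (List.mem_map_of_mem hA))

/-- The constraints given by a list of TGDs. -/
def tgds (T : List (List Atom × List Atom)) : Set Constraint := {β | ∃ r ∈ T, β = Sum.inl r}

/-- This relies on there being no EGDs: TGD steps only add facts and never rewrite values. -/
theorem Reaches.subset {T : List (List Atom × List Atom)} {I J : Instance}
    (h : Reaches (tgds T) I J) : I ⊆ J := by
  induction h with
  | refl => exact Finset.Subset.refl _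
  | tail _ hs ih =>
    obtain ⟨_, ⟨⟨φ, ψ⟩, _, rfl⟩, a, _, b, _, rfl⟩ := hs
    exact ih.trans Finset.subset_union_left

/-- A relation symbol that occurs in no head is not populated by the chase. -/
theorem Reaches.not_mem {T : List (List Atom × List Atom)} {I J : Instance} {i : ℕ}
    (hT : ∀ r ∈ T, ∀ A ∈ r.2, A.1 ≠ i) (h : Reaches (tgds T) I J) (hI : ∀ F ∈ I, F.1 ≠ i) :
    ∀ F ∈ J, F.1 ≠ i := by
  induction h with
  | refl => exact hI
  | tail _ hs ih =>
    obtain ⟨_, ⟨⟨φ, ψ⟩, hr, rfl⟩, a, _, b, _, rfl⟩ := hs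
    intro F hF
    rcases Finset.mem_union.1 hF with hF | hF
    · exact ih F hF
    · obtain ⟨A, hA, rfl⟩ := List.mem_map.1 (List.mem_toFinset.1 hF)
      exact hT _ hr A hA

/-! ### Homomorphisms into a possibly infinite model -/

section Model

variable {D : Type*} (M : ℕ → List D → Prop)

/-- `h` maps every fact of `I` to a true one. -/
def IsHom (h : Value → D) (I : Instance) : Prop := ∀ F ∈ I, M F.1 (F.2.map h)

/-- The conjunction of atoms is true when `g` interprets the constants and `e` the
variables. -/
def ModelHolds (g e : ℕ → D) (φ : List Atom) : Prop :=
  ∀ A ∈ φ, M A.1 (A.2.map (Sum.elim g e))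

/-- The TGD is true in `M`, whatever the meaning of the constants is. -/
def ModelSatisfies (r : List Atom × List Atom) : Prop :=
  ∀ g e, ModelHolds M g e r.1 → ∃ e', (∀ x, Occurs x r.1 → e' x = e x) ∧ ModelHolds M g e' r.2

variable {M}

theorem IsHom.modelHolds {h : Value → D} {I : Instance} (hh : IsHom M h I) {φ : List Atom}
    {a : Assignment} (ha : Holds I a φ) : ModelHolds M (h ∘ Sum.inl) (h ∘ a) φ := fun A hA => by
  have := hh _ (ha A hA)
  simp only [atomFact, List.map_map] at this
  rw [show A.2.map (Sum.elim (h ∘ Sum.inl) (h ∘ a)) = A.2.map (h ∘ termValue a) from ?_]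
  · exact this
  refine List.map_congr_left fun t _ => ?_
  rcases t with c | x <;> rfl

/-- Truth of the TGD in the model yields values for its existential variables; the new nulls are
sent to these values. This is well defined because the nulls are pairwise distinct, and it leaves
the old facts alone because the nulls are fresh. -/
theorem IsHom.chaseStep {h : Value → D} {I J : Instance} (hh : IsHom M h I)
    {r : List Atom × List Atom} (hr : ModelSatisfies M r) {a : Assignment}
    (hs : ChaseStep (Sum.inl r) a I J) : ∃ h', IsHom M h' J := by
  classical
  obtain ⟨φ, ψ⟩ := r
  obtain ⟨hn, b, ⟨hab, hfresh, hinj⟩, rfl⟩ := hs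
  have ha : Holds I a φ := by
    by_contra hc
    exact hn fun hc' => absurd hc' hc
  obtain ⟨e, he, hψ⟩ := hr _ _ (hh.modelHolds ha)
  let isNew : Value → ℕ → Prop := fun v y => Occurs y ψ ∧ ¬ Occurs y φ ∧ b y = v
  let h' : Value → D := fun v => if hv : ∃ y, isNew v y then e hv.choose else h v
  have hconst : ∀ c, h' (Sum.inl c) = h (Sum.inl c) := fun c => by
    refine dif_neg ?_
    rintro ⟨y, hy, hy', hb⟩
    obtain ⟨⟨n, hn⟩, -⟩ := hfresh y hy hy'
    simp [hn] at hb
  have hold : ∀ v, InDom I v → h' v = h v := fun v hv => by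
    refine dif_neg ?_
    rintro ⟨y, hy, hy', rfl⟩
    exact (hfresh y hy hy').2 hv
  have hnew : ∀ y, Occurs y ψ → ¬ Occurs y φ → h' (b y) = e y := fun y hy hy' => by
    have hv : ∃ z, isNew (b y) z := ⟨y, hy, hy', rfl⟩
    have : hv.choose = y :=
      hinj _ _ hv.choose_spec.1 hv.choose_spec.2.1 hy hy' hv.choose_spec.2.2
    simp only [h', dif_pos hv, this]
  refine ⟨h', fun F hF => ?_⟩
  rcases Finset.mem_union.1 hF with hF | hF
  · have : F.2.map h' = F.2.map h := List.map_congr_left fun v hv => hold v ⟨F, hF, hv⟩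
    rw [this]
    exact hh F hF
  · obtain ⟨A, hA, rfl⟩ := List.mem_map.1 (List.mem_toFinset.1 hF)
    have : (atomFact b A).2.map h' = A.2.map (Sum.elim (h ∘ Sum.inl) e) := by
      simp only [atomFact, List.map_map]
      refine List.map_congr_left fun t ht => ?_
      rcases t with c | x
      · exact hconst c
      -- A variable of the body takes a value already in the instance, where `h'` equals `h`; any
      -- other variable of the head takes a new null.
      · by_cases hx : Occurs x φ
        · obtain ⟨B, hB, hxB⟩ := hx
          have hdom : InDom I (a x) :=
            ⟨_, ha B hB, List.mem_map.2 ⟨_, hxB, rfl⟩⟩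
          simp only [Function.comp, termValue, Sum.elim_inr]
          rw [hab x ⟨B, hB, hxB⟩, hold _ hdom, he x ⟨B, hB, hxB⟩]
          rfl
        · exact hnew x ⟨A, hA, ht⟩ hx
    rw [this]
    exact hψ A hA

theorem ChaseSequence.exists_isHom {T : List (List Atom × List Atom)} {I : Instance}
    (hT : ∀ r ∈ T, ModelSatisfies M r) {h : Value → D} (hh : IsHom M h I)
    (s : ChaseSequence (tgds T) I) (n : ℕ) (hn : (n : ℕ∞) ≤ s.len) :
    ∃ h', IsHom M h' (s.inst n) := by
  induction n with
  | zero => exact ⟨h, by rwa [s.start]⟩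
  | succ n ih =>
    have hlt : (n : ℕ∞) < s.len := lt_of_lt_of_le (by exact_mod_cast n.lt_succ_self) hn
    obtain ⟨k, hk⟩ := ih hlt.le
    obtain ⟨r, hr, hcon⟩ := s.con_mem n hlt
    have hs := s.step n hlt
    rw [hcon] at hs
    exact hk.chaseStep (hT r hr) hs

/-- A TGD that fires has a body that is true in the model. -/
theorem exists_modelHolds_of_not_irrelevant {T : List (List Atom × List Atom)} {I : Instance}
    (hT : ∀ r ∈ T, ModelSatisfies M r) {h : Value → D} (hh : IsHom M h I)
    {r : List Atom × List Atom} (hi : ¬ Irrelevant I (tgds T) (Sum.inl r)) :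
    ∃ g e, ModelHolds M g e r.1 := by
  rw [Irrelevant, not_not] at hi
  obtain ⟨s, n, hn, hs⟩ := hi
  obtain ⟨k, hk⟩ := s.exists_isHom hT hh n hn.le
  have hstep := (s.step n hn).1
  rw [hs] at hstep
  refine ⟨_, _, hk.modelHolds (a := s.asg n) ?_⟩
  by_contra hc
  exact hstep fun hc' => absurd hc' hc

end Model

open Turing.ToPartrec

/-! ### Chase rules for the evaluation of programs

The programs `Turing.ToPartrec.Code` act on lists of natural numbers. The relation symbols are
`0`: `n` is zero; `1`: `m = n + 1`; `2`: the list `x` has head `n` and tail `l` (where the empty list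
has head `0` and tail `[]`); `3` to `9`: the program `c` is built by `zero'`, `succ`, `tail`, `cons`,
`comp`, `case` or `fix` from the listed programs; `10`: the list `w` is `x` with its positive head
decreased; `11`: the program `c` maps `x` to `y`; `12`: the program `c` is to be run on `x`;
`13`: the run on `x` has halted. -/

/-- The atom with relation symbol `i` and the variables `xs`. -/
def varAtom (i : ℕ) (xs : List ℕ) : Atom := (i, xs.map Sum.inr)

theorem atomFact_varAtom (a : Assignment) (i : ℕ) (xs : List ℕ) :
    atomFact a (varAtom i xs) = (i, xs.map a) := by
  simp [atomFact, varAtom, termValue]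

theorem holds_cons {I : Instance} {a : Assignment} {i : ℕ} {xs : List ℕ} {φ : List Atom} :
    Holds I a (varAtom i xs :: φ) ↔ (i, xs.map a) ∈ I ∧ Holds I a φ := by
  simp [Holds, atomFact_varAtom]

theorem holds_nil {I : Instance} {a : Assignment} : Holds I a [] ↔ True := by
  simp [Holds]

theorem occurs_cons {x i : ℕ} {xs : List ℕ} {φ : List Atom} :
    Occurs x (varAtom i xs :: φ) ↔ x ∈ xs ∨ Occurs x φ := by
  simp [Occurs, varAtom]

theorem occurs_nil {x : ℕ} : Occurs x [] ↔ False := by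
  simp [Occurs]

theorem modelHolds_cons {D : Type*} {M : ℕ → List D → Prop} {g e : ℕ → D} {i : ℕ} {xs : List ℕ}
    {φ : List Atom} :
    ModelHolds M g e (varAtom i xs :: φ) ↔ M i (xs.map e) ∧ ModelHolds M g e φ := by
  have : ((Sum.elim g e) ∘ Sum.inr) = e := rfl
  simp [ModelHolds, varAtom, this]

theorem modelHolds_nil {D : Type*} {M : ℕ → List D → Prop} {g e : ℕ → D} :
    ModelHolds M g e [] ↔ True := by
  simp [ModelHolds]

/-- The atom with symbol `2` in the body keeps variable `1` universally quantified; without it the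
input would be invented by the head. -/
abbrev zeroRule : List Atom × List Atom :=
  ([varAtom 3 [0], varAtom 2 [1, 2, 3], varAtom 0 [4]], [varAtom 2 [5, 4, 1], varAtom 11 [0, 1, 5]])

/-- Variable `4` is its own tail, which forces it to be the empty list, the tail of the one-element
output. -/
abbrev succRule : List Atom × List Atom :=
  ([varAtom 4 [0], varAtom 2 [1, 2, 3], varAtom 2 [4, 5, 4]],
    [varAtom 1 [2, 6], varAtom 2 [7, 6, 4], varAtom 11 [0, 1, 7]])

abbrev tailRule : List Atom × List Atom :=
  ([varAtom 5 [0], varAtom 2 [1, 2, 3]], [varAtom 11 [0, 1, 3]])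

abbrev consRule : List Atom × List Atom :=
  ([varAtom 6 [0, 1, 2], varAtom 11 [1, 3, 4], varAtom 11 [2, 3, 5], varAtom 2 [4, 6, 7]],
    [varAtom 2 [8, 6, 5], varAtom 11 [0, 3, 8]])

abbrev compRule : List Atom × List Atom :=
  ([varAtom 7 [0, 1, 2], varAtom 11 [2, 3, 4], varAtom 11 [1, 4, 5]], [varAtom 11 [0, 3, 5]])

abbrev caseZeroRule : List Atom × List Atom :=
  ([varAtom 8 [0, 1, 2], varAtom 2 [3, 4, 5], varAtom 0 [4], varAtom 11 [1, 5, 6]],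
    [varAtom 11 [0, 3, 6]])

/-- The successor branch of `case` runs on a list that need not be represented yet. This separate
rule creates it first, so that the evaluation of the branch has an input to work on. -/
abbrev predRule : List Atom × List Atom :=
  ([varAtom 2 [0, 1, 2], varAtom 1 [3, 1]], [varAtom 2 [4, 3, 2], varAtom 10 [0, 4]])

abbrev caseSuccRule : List Atom × List Atom :=
  ([varAtom 8 [0, 1, 2], varAtom 10 [3, 4], varAtom 11 [2, 4, 5]], [varAtom 11 [0, 3, 5]])

abbrev fixStopRule : List Atom × List Atom :=
  ([varAtom 9 [0, 1], varAtom 11 [1, 2, 3], varAtom 2 [3, 4, 5], varAtom 0 [4]],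
    [varAtom 11 [0, 2, 5]])

abbrev fixStepRule : List Atom × List Atom :=
  ([varAtom 9 [0, 1], varAtom 11 [1, 2, 3], varAtom 2 [3, 4, 5], varAtom 1 [6, 4],
    varAtom 11 [0, 5, 7]], [varAtom 11 [0, 2, 7]])

abbrev haltRule : List Atom × List Atom :=
  ([varAtom 12 [0, 1], varAtom 11 [0, 1, 2]], [varAtom 13 [1]])

/-- The rules that evaluate programs. -/
abbrev evalRules : List (List Atom × List Atom) :=
  [zeroRule, succRule, tailRule, consRule, compRule, caseZeroRule, predRule, caseSuccRule,
    fixStopRule, fixStepRule]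

abbrev allRules : List (List Atom × List Atom) := haltRule :: evalRules

/-- The arities of the relation symbols. -/
def evalSchema : Schema := [1, 2, 3, 1, 1, 1, 3, 3, 3, 2, 2, 3, 2, 1]

/-! ### The intended model -/

/-- An untyped value of the intended model: it plays the role of a program, of a list and of a
number. -/
structure Denotation where
  prog : Code
  list : List ℕ
  num : ℕ

/-- The true facts of the intended model, in which the program `c₀` is to be run on `v₀`. -/
def Intended (c₀ : Code) (v₀ : List ℕ) : ℕ → List Denotation → Prop
  | 0, [n] => n.num = 0
  | 1, [n, m] => m.num = n.num + 1
  | 2, [x, n, l] => x.list.headI = n.num ∧ x.list.tail = l.list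
  | 3, [c] => c.prog = Code.zero'
  | 4, [c] => c.prog = Code.succ
  | 5, [c] => c.prog = Code.tail
  | 6, [c, f, g] => c.prog = Code.cons f.prog g.prog
  | 7, [c, f, g] => c.prog = Code.comp f.prog g.prog
  | 8, [c, f, g] => c.prog = Code.case f.prog g.prog
  | 9, [c, f] => c.prog = Code.fix f.prog
  | 10, [x, w] => ∃ n, x.list.headI = n + 1 ∧ w.list = n :: x.list.tail
  | 11, [c, x, y] => y.list ∈ c.prog.eval x.list
  | 12, [c, x] => c.prog = c₀ ∧ x.list = v₀
  | 13, [_] => True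
  | _, _ => False

/-! ### Membership in the results of programs, by constructor -/

theorem eq_nil_of_tail_eq_self {l : List ℕ} (h : l.tail = l) : l = [] := by
  cases l with
  | nil => rfl
  | cons a l => simp at h

theorem mem_eval_cons {f g : Code} {v u w : List ℕ} (hu : u ∈ f.eval v) (hw : w ∈ g.eval v) :
    u.headI :: w ∈ (Code.cons f g).eval v := by
  simp only [Code.cons_eval, Part.bind_eq_bind, Part.mem_bind_iff, Part.pure_eq_some,
    Part.mem_some_iff]
  exact ⟨u, hu, w, hw, rfl⟩

theorem mem_eval_comp {f g : Code} {v u w : List ℕ} (hu : u ∈ g.eval v) (hw : w ∈ f.eval u) :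
    w ∈ (Code.comp f g).eval v := by
  rw [Code.comp_eval]
  exact Part.mem_bind_iff.2 ⟨u, hu, hw⟩

theorem eval_case_of_headI_eq_zero {f g : Code} {v : List ℕ} (h : v.headI = 0) :
    (Code.case f g).eval v = f.eval v.tail := by
  simp [Code.case_eval, h]

theorem eval_case_of_headI_eq_succ {f g : Code} {v : List ℕ} {n : ℕ} (h : v.headI = n + 1) :
    (Code.case f g).eval v = g.eval (n :: v.tail) := by
  simp [Code.case_eval, h]

/-- One unfolding of the loop; its two cases are the clauses `fixStopRule` and `fixStepRule`. -/
theorem mem_eval_fix {f : Code} {v w : List ℕ} :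
    w ∈ (Code.fix f).eval v ↔ ∃ u ∈ f.eval v,
      (u.headI = 0 ∧ w = u.tail) ∨ (u.headI ≠ 0 ∧ w ∈ (Code.fix f).eval u.tail) := by
  rw [Code.fix_eval]
  refine PFun.mem_fix_iff.trans ?_
  simp only [Part.mem_map_iff]
  constructor
  · rintro (⟨u, hu, h⟩ | ⟨v', ⟨u, hu, h⟩, hw⟩) <;> split_ifs at h with h0 <;> cases h
    · exact ⟨u, hu, Or.inl ⟨h0, rfl⟩⟩
    · exact ⟨u, hu, Or.inr ⟨h0, hw⟩⟩
  · rintro ⟨u, hu, ⟨h0, rfl⟩ | ⟨h0, hw⟩⟩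
    · exact Or.inl ⟨u, hu, by simp [h0]⟩
    · exact Or.inr ⟨_, ⟨u, hu, by simp [h0]⟩, hw⟩

/-- Each rule is a sound clause of the semantics. Only the rules for `zero'`, `succ`, `cons` and the
predecessor have existential variables; `full` covers the others. -/
theorem modelSatisfies_intended (c₀ : Code) (v₀ : List ℕ) :
    ∀ r ∈ allRules, ModelSatisfies (Intended c₀ v₀) r := by
  have full : ∀ (r : List Atom × List Atom),
      (∀ g e, ModelHolds (Intended c₀ v₀) g e r.1 → ModelHolds (Intended c₀ v₀) g e r.2) →
        ModelSatisfies (Intended c₀ v₀) r := fun r h g e he => ⟨e, fun _ _ => rfl, h g e he⟩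
  simp only [allRules, evalRules, List.forall_mem_cons]
  refine ⟨full _ ?_, ?_, ?_, full _ ?_, ?_, full _ ?_, full _ ?_, ?_, full _ ?_, full _ ?_,
    full _ ?_, fun r hr => absurd hr List.not_mem_nil⟩
  · intro g e
    simp [modelHolds_cons, modelHolds_nil, Intended]
  · intro g e
    simp only [modelHolds_cons, modelHolds_nil, occurs_cons, occurs_nil, List.map, Intended]
    rintro ⟨hc, -, hz, -⟩
    -- Only the list component of this witness matters; the program and the number are fillers, as
    -- in the later witnesses for lists.
    refine ⟨Function.update e 5 ⟨Code.zero', 0 :: (e 1).list, 0⟩, fun x hx => ?_, ?_⟩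
    · exact Function.update_of_ne (by rintro rfl; simp at hx) _ _
    · simp [hc, hz]
  · intro g e
    simp only [modelHolds_cons, modelHolds_nil, occurs_cons, occurs_nil, List.map, Intended]
    rintro ⟨hc, ⟨hn, -⟩, ⟨-, hl⟩, -⟩
    refine ⟨Function.update (Function.update e 6 ⟨Code.zero', [], (e 2).num + 1⟩) 7
      ⟨Code.zero', [(e 2).num + 1], 0⟩, fun x hx => ?_, ?_⟩
    · rw [Function.update_of_ne (by rintro rfl; simp at hx),
        Function.update_of_ne (by rintro rfl; simp at hx)]
    · simp [hc, hn, eq_nil_of_tail_eq_self hl]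
  · intro g e
    simp only [modelHolds_cons, modelHolds_nil, List.map, Intended]
    rintro ⟨hc, ⟨-, hl⟩, -⟩
    simp [hc, hl]
  · intro g e
    simp only [modelHolds_cons, modelHolds_nil, occurs_cons, occurs_nil, List.map, Intended]
    rintro ⟨hc, hu, hw, ⟨hn, -⟩, -⟩
    refine ⟨Function.update e 8 ⟨Code.zero', (e 4).list.headI :: (e 5).list, 0⟩, fun x hx => ?_, ?_⟩
    · exact Function.update_of_ne (by rintro rfl; simp at hx) _ _
    · simpa [hc, hn] using mem_eval_cons hu hw
  · intro g e
    simp only [modelHolds_cons, modelHolds_nil, List.map, Intended]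
    rintro ⟨hc, hu, hw, -⟩
    exact ⟨hc ▸ mem_eval_comp hu hw, trivial⟩
  · intro g e
    simp only [modelHolds_cons, modelHolds_nil, List.map, Intended]
    rintro ⟨hc, ⟨hn, hl⟩, hz, hy, -⟩
    rw [hc, eval_case_of_headI_eq_zero (hn.trans hz), hl]
    exact ⟨hy, trivial⟩
  · intro g e
    simp only [modelHolds_cons, modelHolds_nil, occurs_cons, occurs_nil, List.map, Intended]
    rintro ⟨⟨hn, hl⟩, hs, -⟩
    refine ⟨Function.update e 4 ⟨Code.zero', (e 3).num :: (e 2).list, 0⟩, fun x hx => ?_, ?_⟩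
    · exact Function.update_of_ne (by rintro rfl; simp at hx) _ _
    · simp [hn, hl, hs]
  · intro g e
    simp only [modelHolds_cons, modelHolds_nil, List.map, Intended]
    rintro ⟨hc, ⟨n, hn, hl⟩, hy, -⟩
    rw [hc, eval_case_of_headI_eq_succ hn, ← hl]
    exact ⟨hy, trivial⟩
  · intro g e
    simp only [modelHolds_cons, modelHolds_nil, List.map, Intended]
    rintro ⟨hc, hu, ⟨hn, hl⟩, hz, -⟩
    rw [hc, mem_eval_fix]
    exact ⟨⟨_, hu, Or.inl ⟨hn.trans hz, hl.symm⟩⟩, trivial⟩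
  · intro g e
    simp only [modelHolds_cons, modelHolds_nil, List.map, Intended]
    rintro ⟨hc, hu, ⟨hn, hl⟩, hs, hy, -⟩
    rw [hc] at hy ⊢
    rw [mem_eval_fix]
    exact ⟨⟨_, hu, Or.inr ⟨by omega, hl ▸ hy⟩⟩, trivial⟩

/-! ### The chase evaluates programs -/

/-- Induction along the iterations of a halting loop: the input varies while the final output `w`
stays fixed. -/
theorem fix_induction {f : Code} {w : List ℕ} {C : List ℕ → Prop}
    (hbase : ∀ v u, u ∈ f.eval v → u.headI = 0 → w = u.tail → C v)
    (hstep : ∀ v u, u ∈ f.eval v → u.headI ≠ 0 → C u.tail → C v) {v : List ℕ}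
    (h : w ∈ (Code.fix f).eval v) : C v := by
  rw [Code.fix_eval] at h
  refine PFun.fixInduction' h (fun v hv => ?_) (fun v v' _ hv ih => ?_)
  · obtain ⟨u, hu, h⟩ := (Part.mem_map_iff _).1 hv
    split_ifs at h with h0
    exact hbase v u hu h0 (Sum.inl.inj h).symm
  · obtain ⟨u, hu, h⟩ := (Part.mem_map_iff _).1 hv
    split_ifs at h with h0
    exact hstep v u hu h0 (Sum.inr.inj h ▸ ih)

/-- The value represents the number in the instance. -/
def RepNum (I : Instance) : ℕ → Value → Prop
  | 0, x => (0, [x]) ∈ I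
  | n + 1, x => ∃ y, RepNum I n y ∧ (1, [y, x]) ∈ I

/-- The value represents the list in the instance. -/
def RepList (I : Instance) : List ℕ → Value → Prop
  | [], x => ∃ z, RepNum I 0 z ∧ (2, [x, z, x]) ∈ I
  | n :: l, x => ∃ y z, RepNum I n y ∧ RepList I l z ∧ (2, [x, y, z]) ∈ I

/-- The value represents the program in the instance. -/
def RepCode (I : Instance) : Code → Value → Prop
  | .zero', k => (3, [k]) ∈ I
  | .succ, k => (4, [k]) ∈ I
  | .tail, k => (5, [k]) ∈ I
  | .cons f g, k => ∃ a b, RepCode I f a ∧ RepCode I g b ∧ (6, [k, a, b]) ∈ I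
  | .comp f g, k => ∃ a b, RepCode I f a ∧ RepCode I g b ∧ (7, [k, a, b]) ∈ I
  | .case f g, k => ∃ a b, RepCode I f a ∧ RepCode I g b ∧ (8, [k, a, b]) ∈ I
  | .fix f, k => ∃ a, RepCode I f a ∧ (9, [k, a]) ∈ I

theorem RepNum.mono {I J : Instance} (h : I ⊆ J) {n : ℕ} {x : Value}
    (hx : RepNum I n x) : RepNum J n x := by
  induction n generalizing x with
  | zero => exact h hx
  | succ n ih =>
    obtain ⟨y, hy, hs⟩ := hx
    exact ⟨y, ih hy, h hs⟩

theorem RepList.mono {I J : Instance} (h : I ⊆ J) {l : List ℕ} {x : Value}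
    (hx : RepList I l x) : RepList J l x := by
  induction l generalizing x with
  | nil =>
    obtain ⟨z, hz, hs⟩ := hx
    exact ⟨z, hz.mono h, h hs⟩
  | cons n l ih =>
    obtain ⟨y, z, hy, hz, hs⟩ := hx
    exact ⟨y, z, hy.mono h, ih hz, h hs⟩

theorem RepCode.mono {I J : Instance} (h : I ⊆ J) {c : Code} {k : Value}
    (hk : RepCode I c k) : RepCode J c k := by
  induction c generalizing k with
  | zero' => exact h hk
  | succ => exact h hk
  | tail => exact h hk
  | cons f g ihf ihg =>
    obtain ⟨a, b, ha, hb, hs⟩ := hk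
    exact ⟨a, b, ihf ha, ihg hb, h hs⟩
  | comp f g ihf ihg =>
    obtain ⟨a, b, ha, hb, hs⟩ := hk
    exact ⟨a, b, ihf ha, ihg hb, h hs⟩
  | case f g ihf ihg =>
    obtain ⟨a, b, ha, hb, hs⟩ := hk
    exact ⟨a, b, ihf ha, ihg hb, h hs⟩
  | fix f ihf =>
    obtain ⟨a, ha, hs⟩ := hk
    exact ⟨a, ihf ha, h hs⟩

/-- The empty list is represented as its own tail with head zero, matching `headI` and `tail` on
`[]`, so both cases can be treated alike. -/
theorem RepList.split {I : Instance} {l : List ℕ} {x : Value} (hx : RepList I l x) :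
    ∃ y z, RepNum I l.headI y ∧ RepList I l.tail z ∧ (2, [x, y, z]) ∈ I := by
  cases l with
  | nil =>
    obtain ⟨z, hz, hs⟩ := hx
    exact ⟨z, x, hz, ⟨z, hz, hs⟩, hs⟩
  | cons n l => exact hx

/-- The assignment of the listed values to the first variables. -/
def listAssignment (vs : List Value) : Assignment := fun i => vs.getD i (Sum.inl 0)

theorem reaches_of_rule {r : List Atom × List Atom} (hr : r ∈ evalRules) {I : Instance}
    (vs : List Value) (h : Holds I (listAssignment vs) r.1) :
    ∃ J b, Reaches (tgds evalRules) I J ∧ I ⊆ J ∧ AgreeOn r.1 (listAssignment vs) b ∧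
      Holds J b r.2 := by
  obtain ⟨J, b, hJ, hb, hψ⟩ := reaches_tgd_of_holds (S := tgds evalRules) ⟨r, hr, rfl⟩ h
  exact ⟨J, b, hJ, hJ.subset, hb, hψ⟩

/-- From `I`, the chase reaches an instance in which `k` maps `x` to a representation of `w`. -/
def EvalReached (I : Instance) (k x : Value) (w : List ℕ) : Prop :=
  ∃ J y, Reaches (tgds evalRules) I J ∧ RepList J w y ∧ (11, [k, x, y]) ∈ J

theorem EvalReached.of_reaches {I J : Instance} (h : Reaches (tgds evalRules) I J) {k x : Value}
    {w : List ℕ} (hJ : EvalReached J k x w) : EvalReached I k x w := by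
  obtain ⟨K, y, hK, hy⟩ := hJ
  exact ⟨K, y, h.trans hK, hy⟩

/-! ### Single applications of the evaluation rules -/

variable {I : Instance} {k x e : Value} {v w : List ℕ}

/-- The representative `e` of the empty list is a standing supply: it provides the value zero here
and the tail of the output in `evalReached_succ`. -/
theorem evalReached_zero (hk : RepCode I .zero' k) (hx : RepList I v x) (he : RepList I [] e) :
    EvalReached I k x (0 :: v) := by
  obtain ⟨n, l, -, -, hs⟩ := hx.split
  obtain ⟨z, hz, -⟩ := he
  simp only [RepCode] at hk
  have hz' := hz
  simp only [RepNum] at hz'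
  obtain ⟨J, b, hJ, hIJ, hb, hψ⟩ := reaches_of_rule (I := I) (r := zeroRule) (by simp)
    [k, x, n, l, z] (by simp [holds_cons, holds_nil, listAssignment, *])
  simp [AgreeOn, occurs_cons, occurs_nil, listAssignment] at hb
  simp [holds_cons, holds_nil, hb] at hψ
  exact ⟨J, b 5, hJ, ⟨z, x, hz.mono hIJ, hx.mono hIJ, hψ.1⟩, hψ.2⟩

theorem evalReached_succ (hk : RepCode I .succ k) (hx : RepList I v x) (he : RepList I [] e) :
    EvalReached I k x [v.headI + 1] := by
  obtain ⟨n, l, hn, -, hs⟩ := hx.split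
  have he' := he
  obtain ⟨z, hz, hez⟩ := he'
  simp only [RepCode] at hk
  obtain ⟨J, b, hJ, hIJ, hb, hψ⟩ := reaches_of_rule (I := I) (r := succRule) (by simp)
    [k, x, n, l, e, z] (by simp [holds_cons, holds_nil, listAssignment, *])
  simp [AgreeOn, occurs_cons, occurs_nil, listAssignment] at hb
  simp [holds_cons, holds_nil, hb] at hψ
  exact ⟨J, b 7, hJ, ⟨b 6, e, ⟨n, hn.mono hIJ, hψ.1⟩, he.mono hIJ, hψ.2.1⟩, hψ.2.2⟩

theorem evalReached_tail (hk : RepCode I .tail k) (hx : RepList I v x) :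
    EvalReached I k x v.tail := by
  obtain ⟨n, l, -, hl, hs⟩ := hx.split
  simp only [RepCode] at hk
  obtain ⟨J, b, hJ, hIJ, hb, hψ⟩ := reaches_of_rule (I := I) (r := tailRule) (by simp) [k, x, n, l]
    (by simp [holds_cons, holds_nil, listAssignment, *])
  simp [AgreeOn, occurs_cons, occurs_nil, listAssignment] at hb
  simp [holds_cons, holds_nil, hb] at hψ
  exact ⟨J, l, hJ, hl.mono hIJ, hψ⟩

theorem evalReached_cons {f g y z : Value} (hk : (6, [k, f, g]) ∈ I) (hf : (11, [f, x, y]) ∈ I)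
    (hy : RepList I v y) (hg : (11, [g, x, z]) ∈ I) (hz : RepList I w z) :
    EvalReached I k x (v.headI :: w) := by
  obtain ⟨n, l, hn, hl, hs⟩ := hy.split
  obtain ⟨J, b, hJ, hIJ, hb, hψ⟩ := reaches_of_rule (I := I) (r := consRule) (by simp)
    [k, f, g, x, y, z, n, l] (by simp [holds_cons, holds_nil, listAssignment, *])
  simp [AgreeOn, occurs_cons, occurs_nil, listAssignment] at hb
  simp [holds_cons, holds_nil, hb] at hψ
  exact ⟨J, b 8, hJ, ⟨n, z, hn.mono hIJ, hz.mono hIJ, hψ.1⟩, hψ.2⟩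

theorem evalReached_comp {f g y z : Value} (hk : (7, [k, f, g]) ∈ I) (hg : (11, [g, x, y]) ∈ I)
    (hf : (11, [f, y, z]) ∈ I) (hz : RepList I w z) : EvalReached I k x w := by
  obtain ⟨J, b, hJ, hIJ, hb, hψ⟩ := reaches_of_rule (I := I) (r := compRule) (by simp)
    [k, f, g, x, y, z] (by simp [holds_cons, holds_nil, listAssignment, *])
  simp [AgreeOn, occurs_cons, occurs_nil, listAssignment] at hb
  simp [holds_cons, holds_nil, hb] at hψ
  exact ⟨J, z, hJ, hz.mono hIJ, hψ⟩

theorem evalReached_case_zero {f g n l y : Value} (hk : (8, [k, f, g]) ∈ I)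
    (hs : (2, [x, n, l]) ∈ I) (hn : (0, [n]) ∈ I) (hf : (11, [f, l, y]) ∈ I)
    (hy : RepList I w y) : EvalReached I k x w := by
  obtain ⟨J, b, hJ, hIJ, hb, hψ⟩ := reaches_of_rule (I := I) (r := caseZeroRule) (by simp)
    [k, f, g, x, n, l, y] (by simp [holds_cons, holds_nil, listAssignment, *])
  simp [AgreeOn, occurs_cons, occurs_nil, listAssignment] at hb
  simp [holds_cons, holds_nil, hb] at hψ
  exact ⟨J, y, hJ, hy.mono hIJ, hψ⟩

theorem reaches_pred {n : ℕ} (hv : v.headI = n + 1) (hx : RepList I v x) :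
    ∃ J y, Reaches (tgds evalRules) I J ∧ RepList J (n :: v.tail) y ∧ (10, [x, y]) ∈ J := by
  obtain ⟨m, l, hm, hl, hs⟩ := hx.split
  rw [hv] at hm
  obtain ⟨p, hp, hpm⟩ := hm
  obtain ⟨J, b, hJ, hIJ, hb, hψ⟩ := reaches_of_rule (I := I) (r := predRule) (by simp)
    [x, m, l, p] (by simp [holds_cons, holds_nil, listAssignment, *])
  simp [AgreeOn, occurs_cons, occurs_nil, listAssignment] at hb
  simp [holds_cons, holds_nil, hb] at hψ
  exact ⟨J, b 4, hJ, ⟨p, l, hp.mono hIJ, hl.mono hIJ, hψ.1⟩, hψ.2⟩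

theorem evalReached_case_succ {f g z y : Value} (hk : (8, [k, f, g]) ∈ I)
    (hp : (10, [x, z]) ∈ I) (hg : (11, [g, z, y]) ∈ I) (hy : RepList I w y) :
    EvalReached I k x w := by
  obtain ⟨J, b, hJ, hIJ, hb, hψ⟩ := reaches_of_rule (I := I) (r := caseSuccRule) (by simp)
    [k, f, g, x, z, y] (by simp [holds_cons, holds_nil, listAssignment, *])
  simp [AgreeOn, occurs_cons, occurs_nil, listAssignment] at hb
  simp [holds_cons, holds_nil, hb] at hψ
  exact ⟨J, y, hJ, hy.mono hIJ, hψ⟩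

theorem evalReached_fix_stop {f y : Value} (hk : (9, [k, f]) ∈ I) (hf : (11, [f, x, y]) ∈ I)
    (hy : RepList I v y) (hv : v.headI = 0) : EvalReached I k x v.tail := by
  obtain ⟨n, l, hn, hl, hs⟩ := hy.split
  simp only [hv, RepNum] at hn
  obtain ⟨J, b, hJ, hIJ, hb, hψ⟩ := reaches_of_rule (I := I) (r := fixStopRule) (by simp)
    [k, f, x, y, n, l] (by simp [holds_cons, holds_nil, listAssignment, *])
  simp [AgreeOn, occurs_cons, occurs_nil, listAssignment] at hb
  simp [holds_cons, holds_nil, hb] at hψ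
  exact ⟨J, l, hJ, hl.mono hIJ, hψ⟩

theorem evalReached_fix_step {f y n m l z : Value} (hk : (9, [k, f]) ∈ I)
    (hf : (11, [f, x, y]) ∈ I) (hs : (2, [y, m, l]) ∈ I) (hm : (1, [n, m]) ∈ I)
    (hr : (11, [k, l, z]) ∈ I) (hz : RepList I w z) : EvalReached I k x w := by
  obtain ⟨J, b, hJ, hIJ, hb, hψ⟩ := reaches_of_rule (I := I) (r := fixStepRule) (by simp)
    [k, f, x, y, m, l, n, z] (by simp [holds_cons, holds_nil, listAssignment, *])
  simp [AgreeOn, occurs_cons, occurs_nil, listAssignment] at hb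
  simp [holds_cons, holds_nil, hb] at hψ
  exact ⟨J, z, hJ, hz.mono hIJ, hψ⟩

/-- Structural induction on the program. The instance is generalized because each subprogram is run
in the instance left behind by the previous one; earlier facts survive since the chase only adds
facts. -/
theorem evalReached_of_mem_eval {c : Code} {v w : List ℕ} (hw : w ∈ c.eval v) {I : Instance}
    {k x e : Value} (hk : RepCode I c k) (hx : RepList I v x) (he : RepList I [] e) :
    EvalReached I k x w := by
  induction c generalizing v w I k x with
  | zero' =>
    obtain rfl : w = 0 :: v := by simpa using hw
    exact evalReached_zero hk hx he
  | succ =>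
    obtain rfl : w = [v.headI + 1] := by simpa using hw
    exact evalReached_succ hk hx he
  | tail =>
    obtain rfl : w = v.tail := by simpa using hw
    exact evalReached_tail hk hx
  | cons f g ihf ihg =>
    obtain ⟨a, b, ha, hb, hs⟩ := hk
    simp only [Code.cons_eval, Part.bind_eq_bind, Part.mem_bind_iff, Part.pure_eq_some,
      Part.mem_some_iff] at hw
    obtain ⟨u, hu, t, ht, rfl⟩ := hw
    obtain ⟨J, y, hJ, hy, hay⟩ := ihf hu ha hx he
    have hIJ := hJ.subset
    obtain ⟨K, z, hK, hz, hbz⟩ := ihg ht (hb.mono hIJ) (hx.mono hIJ) (he.mono hIJ)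
    have hJK := hK.subset
    exact .of_reaches (hJ.trans hK)
      (evalReached_cons (hJK (hIJ hs)) (hJK hay) (hy.mono hJK) hbz hz)
  | comp f g ihf ihg =>
    obtain ⟨a, b, ha, hb, hs⟩ := hk
    rw [Code.comp_eval] at hw
    obtain ⟨u, hu, hw⟩ := Part.mem_bind_iff.1 hw
    obtain ⟨J, y, hJ, hy, hby⟩ := ihg hu hb hx he
    have hIJ := hJ.subset
    obtain ⟨K, z, hK, hz, haz⟩ := ihf hw (ha.mono hIJ) hy (he.mono hIJ)
    have hJK := hK.subset
    exact .of_reaches (hJ.trans hK) (evalReached_comp (hJK (hIJ hs)) (hJK hby) haz hz)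
  | case f g ihf ihg =>
    obtain ⟨a, b, ha, hb, hs⟩ := hk
    rcases hv : v.headI with _ | n
    · rw [eval_case_of_headI_eq_zero hv] at hw
      obtain ⟨n, l, hn, hl, hsp⟩ := hx.split
      rw [hv] at hn
      obtain ⟨J, y, hJ, hy, hay⟩ := ihf hw ha hl he
      have hIJ := hJ.subset
      exact .of_reaches hJ (evalReached_case_zero (hIJ hs) (hIJ hsp) (hIJ hn) hay hy)
    · rw [eval_case_of_headI_eq_succ hv] at hw
      obtain ⟨J, y, hJ, hy, hxy⟩ := reaches_pred hv hx
      have hIJ := hJ.subset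
      obtain ⟨K, z, hK, hz, hbz⟩ := ihg hw (hb.mono hIJ) hy (he.mono hIJ)
      have hJK := hK.subset
      exact .of_reaches (hJ.trans hK) (evalReached_case_succ (hJK (hIJ hs)) (hJK hxy) hbz hz)
  | fix f ihf =>
    obtain ⟨a, ha, hs⟩ := hk
    -- The inner induction runs over the iterations. Instance and input change between iterations,
    -- while the values `k` and `a` of the loop and its body persist.
    suffices ∀ I x, RepList I v x → RepCode I f a → RepList I [] e → (9, [k, a]) ∈ I →
        EvalReached I k x w from this I x hx ha he hs
    refine fix_induction (C := fun v => ∀ I x, RepList I v x → RepCode I f a → RepList I [] e →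
      (9, [k, a]) ∈ I → EvalReached I k x w) ?_ ?_ hw
    · intro v u hu h0 hw I x hx ha he hs
      obtain ⟨J, y, hJ, hy, hay⟩ := ihf hu ha hx he
      exact .of_reaches hJ (hw ▸ evalReached_fix_stop (hJ.subset hs) hay hy h0)
    · intro v u hu h0 ih I x hx ha he hs
      obtain ⟨J, y, hJ, hy, hay⟩ := ihf hu ha hx he
      have hIJ := hJ.subset
      obtain ⟨m, l, hm, hl, hsp⟩ := hy.split
      obtain ⟨n, hn⟩ := Nat.exists_eq_succ_of_ne_zero h0
      rw [hn] at hm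
      obtain ⟨p, -, hpm⟩ := hm
      obtain ⟨K, z, hK, hz, hkz⟩ := ih J l hl (ha.mono hIJ) (he.mono hIJ) (hIJ hs)
      have hJK := hK.subset
      exact .of_reaches (hJ.trans hK)
        (evalReached_fix_step (hJK (hIJ hs)) (hJK hay) (hJK hsp) (hJK hpm) hkz hz)

/-! ### The initial instance -/

/-- An injective numbering of the programs. -/
def codeNumber : Code → ℕ
  | .zero' => 0
  | .succ => 1
  | .tail => 2
  | .cons f g => 4 * Nat.pair (codeNumber f) (codeNumber g) + 3
  | .comp f g => 4 * Nat.pair (codeNumber f) (codeNumber g) + 4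
  | .case f g => 4 * Nat.pair (codeNumber f) (codeNumber g) + 5
  | .fix f => 4 * codeNumber f + 6

/-- The four compound constructors have distinct residues modulo 4 and values at least 3, so they
avoid each other and the numbers 0, 1, 2 of the basic programs. -/
theorem codeNumber_injective : Function.Injective codeNumber := by
  intro c
  induction c with
  | zero' => intro d h; cases d <;> simp [codeNumber] at h ⊢
  | succ => intro d h; cases d <;> simp [codeNumber] at h ⊢
  | tail => intro d h; cases d <;> simp [codeNumber] at h ⊢
  | cons f g ihf ihg =>
    intro d h
    cases d <;> simp only [codeNumber] at h <;> try omega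
    obtain ⟨h₁, h₂⟩ := Nat.pair_eq_pair.1
      (Nat.eq_of_mul_eq_mul_left (by norm_num) (Nat.add_right_cancel h))
    rw [ihf h₁, ihg h₂]
  | comp f g ihf ihg =>
    intro d h
    cases d <;> simp only [codeNumber] at h <;> try omega
    obtain ⟨h₁, h₂⟩ := Nat.pair_eq_pair.1
      (Nat.eq_of_mul_eq_mul_left (by norm_num) (Nat.add_right_cancel h))
    rw [ihf h₁, ihg h₂]
  | case f g ihf ihg =>
    intro d h
    cases d <;> simp only [codeNumber] at h <;> try omega
    obtain ⟨h₁, h₂⟩ := Nat.pair_eq_pair.1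
      (Nat.eq_of_mul_eq_mul_left (by norm_num) (Nat.add_right_cancel h))
    rw [ihf h₁, ihg h₂]
  | fix f ihf =>
    intro d h
    cases d <;> simp only [codeNumber] at h <;> try omega
    rw [ihf (Nat.eq_of_mul_eq_mul_left (by norm_num) (Nat.add_right_cancel h))]

/-- The constant that stands for a program. -/
def codeValue (c : Code) : Value := Sum.inl (codeNumber c)

/-- The facts that describe a program. -/
def codeFacts : Code → List Fact
  | .zero' => [(3, [codeValue .zero'])]
  | .succ => [(4, [codeValue .succ])]
  | .tail => [(5, [codeValue .tail])]
  | .cons f g => (6, [codeValue (.cons f g), codeValue f, codeValue g]) ::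
      (codeFacts f ++ codeFacts g)
  | .comp f g => (7, [codeValue (.comp f g), codeValue f, codeValue g]) ::
      (codeFacts f ++ codeFacts g)
  | .case f g => (8, [codeValue (.case f g), codeValue f, codeValue g]) ::
      (codeFacts f ++ codeFacts g)
  | .fix f => (9, [codeValue (.fix f), codeValue f]) :: codeFacts f

/-- The facts that describe the program `c` and its input `[n]`. The constant `k` stands for the
number `k`; moreover, `0` stands for the list `[]` and `1` for the list `[n]`. -/
def inputFacts (c : Code) (n : ℕ) : List Fact :=
  (2, [Sum.inl 1, Sum.inl n, Sum.inl 0]) ::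
    ((List.range n).map (fun k => ((1, [Sum.inl k, Sum.inl (k + 1)]) : Fact)) ++
      ((0, [Sum.inl 0]) :: (2, [Sum.inl 0, Sum.inl 0, Sum.inl 0]) ::
        (12, [codeValue c, Sum.inl 1]) :: codeFacts c))

/-- The program is fixed, so its facts form a constant list; only the successor chain and the head
of the input depend on `n`. -/
theorem computable_inputFacts (c : Code) : Computable (inputFacts c) := by
  have hl : ∀ {α : Type} [Primcodable α] {f : α → ℕ}, Primrec f →
      Primrec fun x => (Sum.inl (f x) : Value) := fun hf => Primrec.sumInl.comp hf
  refine Primrec.to_comp (Primrec.list_cons.comp ?_ (Primrec.list_append.comp ?_ (Primrec.const _)))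
  · exact Primrec.pair (Primrec.const _) (Primrec.list_cons.comp (Primrec.const _)
      (Primrec.list_cons.comp (hl Primrec.id) (Primrec.const _)))
  · refine Primrec.list_map Primrec.list_range ?_
    exact Primrec.pair (Primrec.const _) (Primrec.list_cons.comp (hl Primrec.snd)
      (Primrec.list_cons.comp (hl (Primrec.succ.comp Primrec.snd)) (Primrec.const _)))

/-! ### Well-formedness of the rules and the initial facts -/

theorem overSchema_of_getElem? {i : ℕ} {k : ℕ+} {xs : List (ℕ ⊕ ℕ)} (h : evalSchema[i]? = some k)
    (hx : xs.length = (k : ℕ)) : OverSchema evalSchema (i, xs) :=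
  ⟨k, h, hx⟩

theorem overSchema_codeFacts (c : Code) : ∀ F ∈ codeFacts c, OverSchema evalSchema F := by
  induction c with
  | zero' | succ | tail =>
    simp only [codeFacts, List.forall_mem_singleton]
    exact overSchema_of_getElem? rfl rfl
  | cons f g ihf ihg | comp f g ihf ihg | case f g ihf ihg =>
    simp only [codeFacts, List.forall_mem_cons, List.forall_mem_append]
    exact ⟨overSchema_of_getElem? rfl rfl, ihf, ihg⟩
  | fix f ihf =>
    simp only [codeFacts, List.forall_mem_cons]
    exact ⟨overSchema_of_getElem? rfl rfl, ihf⟩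

theorem isInstance_inputFacts (c : Code) (n : ℕ) :
    IsInstance evalSchema (inputFacts c n).toFinset := by
  simp only [IsInstance, List.mem_toFinset, inputFacts, List.forall_mem_cons,
    List.forall_mem_append, List.forall_mem_map]
  exact ⟨overSchema_of_getElem? rfl rfl, fun _ _ => overSchema_of_getElem? rfl rfl,
    overSchema_of_getElem? rfl rfl, overSchema_of_getElem? rfl rfl,
    overSchema_of_getElem? rfl rfl, overSchema_codeFacts c⟩

theorem isConstraint_allRules : ∀ β ∈ allRules.map Sum.inl, IsConstraint evalSchema β := by
  simp only [List.forall_mem_map, allRules, evalRules, List.forall_mem_cons, IsConstraint]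
  refine ⟨?_, ?_, ?_, ?_, ?_, ?_, ?_, ?_, ?_, ?_, ?_, by simp⟩ <;> refine ⟨by simp, ?_, ?_⟩ <;>
    repeat' first
      | exact overSchema_of_getElem? rfl rfl
      | exact fun _ h => absurd h List.not_mem_nil
      | apply And.intro

theorem codeFacts_ne_halt (c : Code) : ∀ F ∈ codeFacts c, F.1 ≠ 13 := by
  induction c with
  | zero' | succ | tail => simp [codeFacts]
  | cons f g ihf ihg | comp f g ihf ihg | case f g ihf ihg =>
    simp only [codeFacts, List.forall_mem_cons, List.forall_mem_append]
    exact ⟨by simp, ihf, ihg⟩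
  | fix f ihf =>
    simp only [codeFacts, List.forall_mem_cons]
    exact ⟨by simp, ihf⟩

theorem inputFacts_ne_halt (c : Code) (n : ℕ) : ∀ F ∈ (inputFacts c n).toFinset, F.1 ≠ 13 := by
  simp only [List.mem_toFinset, inputFacts, List.forall_mem_cons, List.forall_mem_append,
    List.forall_mem_map]
  exact ⟨by simp, by simp, by simp, by simp, by simp, codeFacts_ne_halt c⟩

/-- The meaning of the values of the initial instance. -/
noncomputable def denote (n : ℕ) (v : Value) : Denotation :=
  let k := v.elim id id
  ⟨Function.invFun codeNumber k, if k = 0 then [] else [n], k⟩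

theorem denote_codeValue_prog (n : ℕ) (c : Code) : (denote n (codeValue c)).prog = c :=
  Function.leftInverse_invFun codeNumber_injective c

theorem intended_codeFacts (c₀ : Code) (v₀ : List ℕ) (n : ℕ) (c : Code) :
    ∀ F ∈ codeFacts c, Intended c₀ v₀ F.1 (F.2.map (denote n)) := by
  induction c with
  | zero' | succ | tail => simp [codeFacts, Intended, denote_codeValue_prog]
  | cons f g ihf ihg | comp f g ihf ihg | case f g ihf ihg =>
    simp only [codeFacts, List.forall_mem_cons, List.forall_mem_append]
    exact ⟨by simp [Intended, denote_codeValue_prog], ihf, ihg⟩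
  | fix f ihf =>
    simp only [codeFacts, List.forall_mem_cons]
    exact ⟨by simp [Intended, denote_codeValue_prog], ihf⟩

/-- One constant may stand for a program, a list and a number at once. This causes no conflict,
since a `Denotation` carries the three meanings in independent components. -/
theorem isHom_denote (c : Code) (n : ℕ) :
    IsHom (Intended c [n]) (denote n) (inputFacts c n).toFinset := by
  simp only [IsHom, List.mem_toFinset, inputFacts, List.forall_mem_cons, List.forall_mem_append,
    List.forall_mem_map]
  refine ⟨?_, fun k _ => ?_, ?_, ?_, ?_, intended_codeFacts c [n] n c⟩
  · simp [Intended, denote]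
  · simp [Intended, denote]
  · simp [Intended, denote]
  · simp [Intended, denote]
  · exact ⟨denote_codeValue_prog n c, by simp [denote]⟩

theorem repCode_of_codeFacts {I : Instance} {c : Code} (h : ∀ F ∈ codeFacts c, F ∈ I) :
    RepCode I c (codeValue c) := by
  induction c with
  | zero' | succ | tail => simpa [codeFacts, RepCode] using h
  | cons f g ihf ihg | comp f g ihf ihg | case f g ihf ihg =>
    simp only [codeFacts, List.forall_mem_cons, List.forall_mem_append] at h
    exact ⟨_, _, ihf h.2.1, ihg h.2.2, h.1⟩
  | fix f ihf =>
    simp only [codeFacts, List.forall_mem_cons] at h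
    exact ⟨_, ihf h.2, h.1⟩

theorem repNum_of_succ {I : Instance} (h0 : (0, [Sum.inl 0]) ∈ I) {n : ℕ}
    (hs : ∀ k < n, (1, [Sum.inl k, Sum.inl (k + 1)]) ∈ I) : RepNum I n (Sum.inl n) := by
  induction n with
  | zero => exact h0
  | succ n ih => exact ⟨_, ih fun k hk => hs k (by omega), hs n (by omega)⟩

/-- The rule that reports termination fires precisely for the terminating runs. -/
theorem irrelevant_haltRule_iff (c : Code) (n : ℕ) :
    Irrelevant (inputFacts c n).toFinset (tgds allRules) (Sum.inl haltRule) ↔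
      ¬ (c.eval [n]).Dom := by
  rw [← not_iff_not, not_not]
  constructor
  · intro h
    obtain ⟨g, e, he⟩ := exists_modelHolds_of_not_irrelevant (modelSatisfies_intended c [n])
      (isHom_denote c n) h
    simp only [modelHolds_cons, List.map, Intended] at he
    obtain ⟨⟨hc, hx⟩, hy, -⟩ := he
    rw [hc, hx] at hy
    exact Part.dom_iff_mem.2 ⟨_, hy⟩
  · intro h
    obtain ⟨w, hw⟩ := Part.dom_iff_mem.1 h
    have hI : ∀ F ∈ inputFacts c n, F ∈ (inputFacts c n).toFinset := fun F => List.mem_toFinset.2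
    set I := (inputFacts c n).toFinset
    have hne : ∀ F ∈ I, F.1 ≠ 13 := inputFacts_ne_halt c n
    simp only [inputFacts, List.forall_mem_cons, List.forall_mem_append,
      List.forall_mem_map, List.mem_range] at hI
    obtain ⟨hx, hs, h0, hnil, hrun, hc⟩ := hI
    have he : RepList I [] (Sum.inl 0) := ⟨_, h0, hnil⟩
    obtain ⟨J, y, hJ, -, hy⟩ := evalReached_of_mem_eval hw (repCode_of_codeFacts hc)
      (x := Sum.inl 1) ⟨_, _, repNum_of_succ h0 hs, he, hx⟩ he
    have hbody : Holds J (listAssignment [codeValue c, Sum.inl 1, y]) haltRule.1 := by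
      simp [holds_cons, holds_nil, listAssignment, hJ.subset hrun, hy]
    -- Symbol `13` is absent from the initial instance and from the heads of the evaluation rules,
    -- so the halting fact cannot be present yet.
    have hhead : ¬ SatisfiesAt J (listAssignment [codeValue c, Sum.inl 1, y])
        (Sum.inl haltRule) := fun hsat => by
      obtain ⟨b, -, hb⟩ := hsat hbody
      have hT : ∀ r ∈ evalRules, ∀ A ∈ r.2, A.1 ≠ 13 := by
        simp only [evalRules, List.forall_mem_cons]
        simp [varAtom]
      exact hJ.not_mem hT hne _ (holds_cons.1 hb).1 rfl
    obtain ⟨b, hb⟩ := exists_freshExtension J haltRule.1 haltRule.2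
      (listAssignment [codeValue c, Sum.inl 1, y])
    refine not_irrelevant_of_reaches (hJ.mono ?_) ⟨haltRule, by simp, rfl⟩
      (show ChaseStep _ _ J _ from ⟨hhead, b, hb, rfl⟩)
    rintro _ ⟨r, hr, rfl⟩
    exact ⟨r, List.mem_cons_of_mem _ hr, rfl⟩

/-! ### Undecidability -/

/-- There is a program with an undecidable halting problem. -/
theorem exists_code_not_computablePred :
    ∃ c : Code, ¬ ComputablePred fun n : ℕ => (c.eval [n]).Dom := by
  -- Decode `n` as a partial recursive program and run it on input 0; a single list program then
  -- simulates `u`.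
  let u : ℕ →. ℕ := fun n => (Denumerable.ofNat Nat.Partrec.Code n).eval 0
  have hu : Partrec u :=
    Nat.Partrec.Code.eval_part.comp (Computable.ofNat _) (Computable.const 0)
  obtain ⟨c, hc⟩ := Code.exists_code (Nat.Partrec'.part_iff₁.2 hu)
  refine ⟨c, fun h => ComputablePred.halting_problem 0 ?_⟩
  have key : ∀ d : Nat.Partrec.Code, (c.eval [Encodable.encode d]).Dom ↔ (d.eval 0).Dom := by
    intro d
    have := hc (Encodable.encode d ::ᵥ List.Vector.nil)
    simp only [List.Vector.head_cons, u, Denumerable.ofNat_encode] at this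
    have h' : c.eval [Encodable.encode d] = pure <$> d.eval 0 := this
    rw [h']
    rfl
  obtain ⟨f, hf, hfe⟩ := ComputablePred.computable_iff.1 h
  refine ComputablePred.computable_iff.2 ⟨_, hf.comp Computable.encode, funext fun d => ?_⟩
  rw [← key d]
  exact congrFun hfe _

end Chase

theorem theorem2 :
    ∃ R : Chase.Schema,
      ¬ ∃ f : List Chase.Constraint × Chase.Constraint × List Chase.Fact → Bool,
        Computable f ∧
        ∀ (S : List Chase.Constraint) (α : Chase.Constraint) (I : List Chase.Fact),
          (∀ β ∈ S, Chase.IsConstraint R β) → α ∈ S → Chase.IsInstance R I.toFinset →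
          (f (S, α, I) = true ↔ Chase.Irrelevant I.toFinset {β | β ∈ S} α) := by
  refine ⟨Chase.evalSchema, ?_⟩
  rintro ⟨f, hf, h⟩
  obtain ⟨c, hc⟩ := Chase.exists_code_not_computablePred
  -- The constraint set and the tested constraint do not depend on `n`, so even the problem with
  -- both of them fixed is undecidable.
  let S : List Chase.Constraint := Chase.allRules.map Sum.inl
  let α : Chase.Constraint := Sum.inl Chase.haltRule
  have hS : {β | β ∈ S} = Chase.tgds Chase.allRules := by
    ext β
    simp only [S, Chase.tgds, Set.mem_ofPred_eq, List.mem_map, eq_comm]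
  have key : ∀ n, f (S, α, Chase.inputFacts c n) = true ↔ ¬ (c.eval [n]).Dom := fun n => by
    rw [h S α _ Chase.isConstraint_allRules (List.mem_map_of_mem List.mem_cons_self)
      (Chase.isInstance_inputFacts c n), hS]
    exact Chase.irrelevant_haltRule_iff c n
  -- Irrelevance corresponds to divergence, hence the negation of `f`.
  refine hc (ComputablePred.computable_iff.2 ⟨fun n => !f (S, α, Chase.inputFacts c n), ?_, ?_⟩)
  · exact Primrec.not.to_comp.comp (hf.comp (Computable.pair (Computable.const S)
      (Computable.pair (Computable.const α) (Chase.computable_inputFacts c))))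
  · funext n
    rw [Bool.not_eq_true', ← Bool.not_eq_true, key n, not_not]
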